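/- **Theorem (normaliser generation).** Let $\mathcal{M}_S$ be the algebra of $n\times n$ complex matrices and let $\mathcal{A}\subseteq\mathcal{M}_S$ be a unital $*$-subalgebra. For a unitary $U\in\mathcal{M}_S$ write $\mathrm{Ad}_U(a)=UaU^\dagger$, and let $$\mathcal{N}(\mathcal{A})=\{U\in\mathcal{M}_S \text{ unitary} : \mathrm{Ad}_U(a)\in\mathcal{A}\ \text{ for all } a\in\mathcal{A}\}$$ be the unitary normaliser of $\mathcal{A}$ (equivalently, the unitaries with $\mathrm{Ad}_U(\mathcal{A})=\mathcal{A}$). Then $\mathcal{A}$ has a block decomposition, that is, there are finitely many pairs of positive integers $(d_i,e_i)$, $i=1,\dots,k$, and a unitary $V:\mathbb{C}^n\to\bigoplus_{i}\mathbb{C}^{d_i}\otimes\mathbb{C}^{e_i}$ such that $$\mathcal{A}=\Big\{V^\dagger\Big(\bigoplus_{i} T_i\otimes\mathbb{1}_{e_i}\Big)V : T_i\in M_{d_i}(\mathbb{C})\Big\};$$ and for every such block decomposition, $\mathcal{N}(\mathcal{A})$ is the group generated by the following three groups of unitaries: 1. $\mathcal{U}_i$, the unitaries that belong to $\mathcal{A}$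 (inner automorphisms); 2. $\mathcal{U}_o$, the unitaries $U$ with $\mathrm{Ad}_U(a)=a$ for all $a\in\mathcal{A}$, i.e. the unitaries in the commutant of $\mathcal{A}$ (elementwise trivial automorphisms); 3. $\mathcal{U}_\pi$, the block permutation unitaries $V^\dagger P_\pi V$, where $\pi$ runs over the permutations of $\{1,\dots,k\}$ with $d_{\pi(i)}=d_i$ and $e_{\pi(i)}=e_i$ for all $i$, and $P_\pi$ maps the standard basis vector $|a\rangle\otimes|b\rangle$ of the $i$-th block to $|a\rangle\otimes|b\rangle$ of the $\pi(i)$-th block. That is, $\mathcal{N}(\mathcal{A})=\langle\,\mathcal{U}_i,\ \mathcal{U}_o,\ \mathcal{U}_\pi\,\rangle$. -/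

import Mathlib

open scoped Matrix Kronecker

namespace WallAlgebra

variable {n : Type*} [Fintype n] [DecidableEq n]

/-- The adjoint action `Ad_U(a) = U a U†` of a unitary matrix on a matrix. -/
def Ad (U : Matrix.unitaryGroup n ℂ) (a : Matrix n n ℂ) : Matrix n n ℂ :=
  (U : Matrix n n ℂ) * a * (U : Matrix n n ℂ)ᴴ

theorem Ad_one (a : Matrix n n ℂ) : Ad 1 a = a := by simp [Ad]

theorem Ad_mul (U V : Matrix.unitaryGroup n ℂ) (a : Matrix n n ℂ) :
    Ad (U * V) a = Ad U (Ad V a) := by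
  simp [Ad, Matrix.mul_assoc]

theorem Ad_inv_Ad (U : Matrix.unitaryGroup n ℂ) (a : Matrix n n ℂ) : Ad U⁻¹ (Ad U a) = a := by
  rw [← Ad_mul, inv_mul_cancel, Ad_one]

/-- In finite dimension a unitary that maps the algebra into itself maps it onto itself. -/
theorem exists_Ad_eq (A : StarSubalgebra ℂ (Matrix n n ℂ)) (U : Matrix.unitaryGroup n ℂ)
    (hU : ∀ a ∈ A, Ad U a ∈ A) (b : Matrix n n ℂ) (hb : b ∈ A) : ∃ a ∈ A, Ad U a = b := by
  let f : A.toSubalgebra.toSubmodule →ₗ[ℂ] A.toSubalgebra.toSubmodule :=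
    { toFun := fun a => ⟨Ad U a.1, hU a.1 a.2⟩
      map_add' := fun a b => Subtype.ext (by simp [Ad, Matrix.mul_add, Matrix.add_mul])
      map_smul' := fun c a => Subtype.ext (by simp [Ad]) }
  have hf : Function.Injective f := by
    intro a b h
    have h' : Ad U a.1 = Ad U b.1 := congrArg Subtype.val h
    exact Subtype.ext (by rw [← Ad_inv_Ad U a.1, h', Ad_inv_Ad])
  obtain ⟨a, ha⟩ := LinearMap.surjective_of_injective hf ⟨b, hb⟩
  exact ⟨a.1, a.2, congrArg Subtype.val ha⟩

/-- The unitary normaliser `N(A) = {U unitary | Ad_U(a) ∈ A for all a ∈ A}`. -/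
def normaliser (A : StarSubalgebra ℂ (Matrix n n ℂ)) : Subgroup (Matrix.unitaryGroup n ℂ) where
  carrier := {U | ∀ a ∈ A, Ad U a ∈ A}
  one_mem' := fun a ha => by rwa [Ad_one]
  mul_mem' := fun {U V} hU hV a ha => by rw [Ad_mul]; exact hU _ (hV _ ha)
  inv_mem' := fun {U} hU a ha => by
    obtain ⟨b, hb, rfl⟩ := exists_Ad_eq A U hU a ha
    rwa [Ad_inv_Ad]

/-- Equivalently, `N(A)` consists of the unitaries with `Ad_U(A) = A`. -/
theorem mem_normaliser_iff (A : StarSubalgebra ℂ (Matrix n n ℂ)) (U : Matrix.unitaryGroup n ℂ) :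
    U ∈ normaliser A ↔ Ad U '' (A : Set (Matrix n n ℂ)) = A := by
  constructor
  · intro hU
    ext b
    constructor
    · rintro ⟨a, ha, rfl⟩
      exact hU a ha
    · intro hb
      exact exists_Ad_eq A U hU b hb
  · intro h a ha
    have : Ad U a ∈ (A : Set (Matrix n n ℂ)) := h ▸ ⟨a, ha, rfl⟩
    exact this

/-- The group of inner automorphisms: the unitaries that lie in the algebra. -/
def innerGroup (A : StarSubalgebra ℂ (Matrix n n ℂ)) : Subgroup (Matrix.unitaryGroup n ℂ) where
  carrier := {U | (U : Matrix n n ℂ) ∈ A}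
  one_mem' := A.one_mem
  mul_mem' := fun hU hV => A.mul_mem hU hV
  inv_mem' := fun {U} hU => by
    have h : star (U : Matrix n n ℂ) ∈ A := star_mem hU
    exact h

/-- The group of elementwise trivial automorphisms: the unitaries `U` with `Ad_U(a) = a` for all
`a ∈ A`. -/
def elementwiseGroup (A : StarSubalgebra ℂ (Matrix n n ℂ)) :
    Subgroup (Matrix.unitaryGroup n ℂ) where
  carrier := {U | ∀ a ∈ A, Ad U a = a}
  one_mem' := fun a _ => Ad_one a
  mul_mem' := fun {U V} hU hV a ha => by rw [Ad_mul, hV a ha, hU a ha]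
  inv_mem' := fun {U} hU a ha => by
    have h := Ad_inv_Ad U a
    rwa [hU a ha] at h

/-- Equivalently, they are the unitaries in the commutant of `A`. -/
theorem mem_elementwiseGroup_iff (A : StarSubalgebra ℂ (Matrix n n ℂ))
    (U : Matrix.unitaryGroup n ℂ) :
    U ∈ elementwiseGroup A ↔
      (U : Matrix n n ℂ) ∈ Set.centralizer (A : Set (Matrix n n ℂ)) := by
  have h1 : (U : Matrix n n ℂ)ᴴ * (U : Matrix n n ℂ) = 1 := Unitary.coe_star_mul_self U
  have h2 : (U : Matrix n n ℂ) * (U : Matrix n n ℂ)ᴴ = 1 := Unitary.coe_mul_star_self U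
  constructor
  · intro h a ha
    have h3 : (U : Matrix n n ℂ) * a * (U : Matrix n n ℂ)ᴴ = a := h a ha
    calc a * (U : Matrix n n ℂ)
        = ((U : Matrix n n ℂ) * a * (U : Matrix n n ℂ)ᴴ) * (U : Matrix n n ℂ) := by rw [h3]
      _ = (U : Matrix n n ℂ) * a := by rw [Matrix.mul_assoc, h1, Matrix.mul_one]
  · intro h a ha
    have h3 : a * (U : Matrix n n ℂ) = (U : Matrix n n ℂ) * a := h a ha
    change (U : Matrix n n ℂ) * a * (U : Matrix n n ℂ)ᴴ = a
    rw [← h3, Matrix.mul_assoc, h2, Matrix.mul_one]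

/-- A decomposition of `ℂⁿ` into irreducible blocks under the algebra `A`: a unitary identification
`V : ℂⁿ ≅ ⨁ i, ℂ^(d i) ⊗ ℂ^(e i)` (all factors nonzero) under which `A` becomes
`⨁ i, M_(d i) ⊗ 1_(e i)`. The triple `⟨i, (a, b)⟩` indexes the basis vector `|a⟩ ⊗ |b⟩` of block
`i`. -/
structure BlockDecomposition (A : StarSubalgebra ℂ (Matrix n n ℂ)) where
  /-- the number of blocks -/
  numBlocks : ℕ
  /-- the dimensions of the irreducible spaces -/
  d : Fin numBlocks → ℕ
  /-- the dimensions of the degeneracy spaces -/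
  e : Fin numBlocks → ℕ
  d_pos : ∀ i, 0 < d i
  e_pos : ∀ i, 0 < e i
  /-- the unitary identification -/
  V : Matrix (Σ i, Fin (d i) × Fin (e i)) n ℂ
  conjTranspose_mul_self : Vᴴ * V = 1
  mul_conjTranspose_self : V * Vᴴ = 1
  mem_iff : ∀ a : Matrix n n ℂ, a ∈ A ↔
    ∃ T : ∀ i, Matrix (Fin (d i)) (Fin (d i)) ℂ,
      a = Vᴴ * Matrix.blockDiagonal' (fun i => T i ⊗ₖ (1 : Matrix (Fin (e i)) (Fin (e i)) ℂ)) * V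

namespace BlockDecomposition

variable {A : StarSubalgebra ℂ (Matrix n n ℂ)} (D : BlockDecomposition A)

/-- The index set of the basis of `⨁ i, ℂ^(d i) ⊗ ℂ^(e i)`. -/
abbrev Index : Type := Σ i, Fin (D.d i) × Fin (D.e i)

/-- The permutations of the block labels that map each block to an equivalent one, that is, to one
whose irreducible and degeneracy spaces have the same dimensions. -/
def labelPerms : Subgroup (Equiv.Perm (Fin D.numBlocks)) where
  carrier := {π | ∀ i, D.d (π i) = D.d i ∧ D.e (π i) = D.e i}
  one_mem' := fun _ => ⟨rfl, rfl⟩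
  mul_mem' := fun {π ρ} hπ hρ i =>
    ⟨(hπ (ρ i)).1.trans (hρ i).1, (hπ (ρ i)).2.trans (hρ i).2⟩
  inv_mem' := fun {π} hπ i => by
    have h := hπ (π⁻¹ i)
    rw [show π (π⁻¹ i) = i from π.apply_symm_apply i] at h
    exact ⟨h.1.symm, h.2.symm⟩

/-- The map `(i, a, b) ↦ (π i, a, b)` of basis labels. -/
def indexMap (π : D.labelPerms) (x : D.Index) : D.Index :=
  ⟨π.1 x.1, Fin.cast (π.2 x.1).1.symm x.2.1, Fin.cast (π.2 x.1).2.symm x.2.2⟩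

theorem index_ext {x y : D.Index} (h : x.1 = y.1) (h1 : (x.2.1 : ℕ) = y.2.1)
    (h2 : (x.2.2 : ℕ) = y.2.2) : x = y := by
  obtain ⟨i, a, b⟩ := x
  obtain ⟨j, a', b'⟩ := y
  dsimp only at h
  subst h
  have ha : a = a' := Fin.ext h1
  have hb : b = b' := Fin.ext h2
  rw [ha, hb]

theorem indexMap_one (x : D.Index) : D.indexMap 1 x = x := rfl

theorem indexMap_mul (π ρ : D.labelPerms) (x : D.Index) :
    D.indexMap (π * ρ) x = D.indexMap π (D.indexMap ρ x) := rfl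

theorem indexMap_injective (π : D.labelPerms) : Function.Injective (D.indexMap π) := by
  intro x y h
  have h' := congrArg (D.indexMap π⁻¹) h
  rwa [← indexMap_mul, ← indexMap_mul, inv_mul_cancel, indexMap_one, indexMap_one] at h'

/-- The matrix sending the basis vector `(i, a, b)` to `(π i, a, b)`. -/
def permMatrix (π : D.labelPerms) : Matrix D.Index D.Index ℂ :=
  Matrix.of fun x y => if x = D.indexMap π y then 1 else 0

theorem permMatrix_one : D.permMatrix 1 = 1 := by
  ext x y
  by_cases h : x = y <;> simp [permMatrix, indexMap_one, Matrix.one_apply, h]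

theorem permMatrix_mul (π ρ : D.labelPerms) :
    D.permMatrix (π * ρ) = D.permMatrix π * D.permMatrix ρ := by
  ext x y
  by_cases h : x = D.indexMap π (D.indexMap ρ y) <;>
    simp [permMatrix, indexMap_mul, Matrix.mul_apply, h]

theorem permMatrix_conjTranspose_mul (π : D.labelPerms) :
    (D.permMatrix π)ᴴ * D.permMatrix π = 1 := by
  ext x y
  simp [permMatrix, Matrix.mul_apply, Matrix.conjTranspose_apply, Matrix.one_apply,
    (D.indexMap_injective π).eq_iff, eq_comm, apply_ite]

/-- The unitary on `ℂⁿ` that permutes the blocks by `π`, as a unitary representation of the group of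
permutations of equivalent blocks. -/
def permUnitary : D.labelPerms →* Matrix.unitaryGroup n ℂ where
  toFun π := ⟨D.Vᴴ * D.permMatrix π * D.V, by
    rw [Matrix.mem_unitaryGroup_iff', Matrix.star_eq_conjTranspose]
    simp only [Matrix.conjTranspose_mul, Matrix.conjTranspose_conjTranspose]
    calc D.Vᴴ * ((D.permMatrix π)ᴴ * D.V) * (D.Vᴴ * D.permMatrix π * D.V)
        = D.Vᴴ * ((D.permMatrix π)ᴴ * (D.V * D.Vᴴ) * D.permMatrix π) * D.V := by
          simp only [Matrix.mul_assoc]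
      _ = 1 := by
          rw [D.mul_conjTranspose_self, Matrix.mul_one, permMatrix_conjTranspose_mul,
            Matrix.mul_one, D.conjTranspose_mul_self]⟩
  map_one' := Subtype.ext (by simp [permMatrix_one, D.conjTranspose_mul_self])
  map_mul' π ρ := Subtype.ext (by
    change D.Vᴴ * D.permMatrix (π * ρ) * D.V =
      (D.Vᴴ * D.permMatrix π * D.V) * (D.Vᴴ * D.permMatrix ρ * D.V)
    calc D.Vᴴ * D.permMatrix (π * ρ) * D.V
        = D.Vᴴ * D.permMatrix π * (D.V * D.Vᴴ) * D.permMatrix ρ * D.V := by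
          rw [D.mul_conjTranspose_self, Matrix.mul_one, permMatrix_mul]
          simp only [Matrix.mul_assoc]
      _ = _ := by simp only [Matrix.mul_assoc])

/-- The block permutation unitary group. -/
def blockPermGroup : Subgroup (Matrix.unitaryGroup n ℂ) := D.permUnitary.range

end BlockDecomposition

end WallAlgebra

/-! The structure of `A` is read off from its minimal projections, the nonzero projections `p ∈ A`
with `p A p = ℂ p`. The identity is a sum of orthogonal minimal projections (`exists_sum_minProj`).
Two of them with `p A q ≠ 0` are linked by a partial isometry in `A`
(`IsMinProj.exists_partialIsometry`), and this is an equivalence relation. Its classes are the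
blocks, the partial isometries yield matrix units, and the range of one projection per class is the
degeneracy space; this gives `exists_blockDecomposition`.

A normalising unitary `U` sends minimal projections to minimal projections and minimal central
projections to minimal central projections (`Ad_centralProj`), so it permutes the blocks. The trace
of a minimal projection is `e i` and that of a central one is `d i * e i`; both are preserved, so
the permutation `ρ` is admissible (`exists_labelPerm`). In the spirit of Skolem–Noether, a unitary
`X ∈ A` then carries the permuted matrix units to their images under `Ad U`
(`exists_inner_mul_perm`). Writing `P` for the block permutation unitary of `ρ`, the unitaries `X *
P` and `U` act equally on `A`, hence differ by a unitary of the commutant. -/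

namespace WallAlgebra

variable {n : Type*} [Fintype n] [DecidableEq n]

/-! ### Minimal projections and their equivalence. -/

/-- A minimal projection of `A`: a nonzero orthogonal projection `p ∈ A` with `p A p = ℂ p`. -/
structure IsMinProj (A : StarSubalgebra ℂ (Matrix n n ℂ)) (p : Matrix n n ℂ) : Prop where
  mem : p ∈ A
  star_eq : pᴴ = p
  mul_self : p * p = p
  ne_zero : p ≠ 0
  corner : ∀ x ∈ A, ∃ c : ℂ, p * x * p = c • p

theorem conjTranspose_mem {A : StarSubalgebra ℂ (Matrix n n ℂ)} {x : Matrix n n ℂ} (hx : x ∈ A) :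
    xᴴ ∈ A := star_mem (s := A) hx

omit [DecidableEq n] in
open scoped ComplexOrder in
theorem trace_conjTranspose_mul_self_pos {v : Matrix n n ℂ} (hv : v ≠ 0) :
    0 < (vᴴ * v).trace :=
  lt_of_le_of_ne (Matrix.posSemidef_conjTranspose_mul_self v).trace_nonneg
    fun h => hv (Matrix.trace_conjTranspose_mul_self_eq_zero_iff.1 h.symm)

/-- Two minimal projections `p, q` with `p A q ≠ 0` are equivalent. -/
theorem IsMinProj.exists_partialIsometry {A : StarSubalgebra ℂ (Matrix n n ℂ)}
    {p q x : Matrix n n ℂ} (hp : IsMinProj A p) (hq : IsMinProj A q) (hx : x ∈ A)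
    (hne : p * x * q ≠ 0) : ∃ u ∈ A, u * uᴴ = p ∧ uᴴ * u = q := by
  set v := p * x * q with hv
  have hvA : v ∈ A := A.mul_mem (A.mul_mem hp.mem hx) hq.mem
  have hvs : vᴴ = q * xᴴ * p := by
    simp [hv, hp.star_eq, hq.star_eq, Matrix.mul_assoc]
  obtain ⟨c, hc⟩ := hq.corner (xᴴ * p * x) (A.mul_mem (A.mul_mem (conjTranspose_mem hx) hp.mem) hx)
  obtain ⟨c', hc'⟩ := hp.corner (x * q * xᴴ) (A.mul_mem (A.mul_mem hx hq.mem) (conjTranspose_mem hx))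
  have h1 : vᴴ * v = c • q := by
    rw [← hc, hvs, hv]
    simp only [Matrix.mul_assoc]
    rw [← Matrix.mul_assoc p p, hp.mul_self]
  have h2 : v * vᴴ = c' • p := by
    rw [← hc', hvs, hv]
    simp only [Matrix.mul_assoc]
    rw [← Matrix.mul_assoc q q, hq.mul_self]
  have hpv : p * v = v := by rw [hv, ← Matrix.mul_assoc, ← Matrix.mul_assoc, hp.mul_self]
  have hvq : v * q = v := by rw [hv, Matrix.mul_assoc _ q, hq.mul_self]
  -- Both scalars appear on evaluating `v * vᴴ * v` with the two bracketings.
  have hcc : c' = c := by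
    have h : c' • v = c • v := by
      calc c' • v = (v * vᴴ) * v := by rw [h2, Matrix.smul_mul, hpv]
        _ = c • v := by rw [Matrix.mul_assoc, h1, Matrix.mul_smul, hvq]
    exact smul_left_injective ℂ hne h
  -- The traces of `vᴴ * v = c • q` and of `q = qᴴ * q` are both positive, so their ratio `c` is
  -- too; rescaling `v` by `1/√c` then gives the partial isometry.
  obtain ⟨r, hr, hrc⟩ : ∃ r : ℝ, 0 < r ∧ (r : ℂ) = c := by
    have t1 := trace_conjTranspose_mul_self_pos hne
    have t2 := trace_conjTranspose_mul_self_pos hq.ne_zero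
    rw [h1, Matrix.trace_smul, smul_eq_mul] at t1
    rw [hq.star_eq, hq.mul_self] at t2
    obtain ⟨t2r, t2i⟩ := Complex.lt_def.1 t2
    obtain ⟨t1r, t1i⟩ := Complex.lt_def.1 t1
    simp only [Complex.zero_re, Complex.zero_im, Complex.mul_re, Complex.mul_im] at *
    rw [← t2i] at t1r t1i
    have hci : c.im = 0 := by
      have : c.im * q.trace.re = 0 := by linarith
      exact (mul_eq_zero.1 this).resolve_right t2r.ne'
    refine ⟨c.re, ?_, Complex.ext rfl hci.symm⟩
    rw [mul_zero, sub_zero] at t1r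
    exact pos_of_mul_pos_left t1r t2r.le
  have hs : ((Real.sqrt r)⁻¹ : ℝ) * ((Real.sqrt r)⁻¹ : ℝ) * (r : ℂ) = 1 := by
    norm_cast
    rw [← mul_inv, Real.mul_self_sqrt hr.le, inv_mul_cancel₀ hr.ne']
  refine ⟨(((Real.sqrt r)⁻¹ : ℝ) : ℂ) • v, A.smul_mem hvA _, ?_, ?_⟩
  · rw [Matrix.conjTranspose_smul, Matrix.smul_mul, Matrix.mul_smul, smul_smul, h2, smul_smul, hcc,
      ← hrc, Complex.star_def, Complex.conj_ofReal, hs, one_smul]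
  · rw [Matrix.conjTranspose_smul, Matrix.smul_mul, Matrix.mul_smul, smul_smul, h1, smul_smul,
      ← hrc, Complex.star_def, Complex.conj_ofReal, hs, one_smul]

/-! ### Splitting projections into minimal ones. -/

/-- The spectral projections of a Hermitian element of a `*`-subalgebra of matrices. -/
theorem exists_spectral_projections (A : StarSubalgebra ℂ (Matrix n n ℂ)) {y : Matrix n n ℂ}
    (hyA : y ∈ A) (hy : yᴴ = y) :
    ∃ (S : Finset ℝ) (s : ℝ → Matrix n n ℂ), (∀ t, s t ∈ A) ∧ (∀ t, (s t)ᴴ = s t) ∧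
      (∀ t, s t * s t = s t) ∧ (∀ t, y * s t = (t : ℂ) • s t) ∧ ∑ t ∈ S, s t = 1 ∧
      ∀ t e, Commute y e → Commute (s t) e := by
  classical
  have hsa : IsSelfAdjoint y := hy
  have hfin : (spectrum ℝ y).Finite := Matrix.finite_real_spectrum
  have hcont (f : ℝ → ℝ) : ContinuousOn f (spectrum ℝ y) := hfin.continuousOn f
  have hclosed : IsClosed (A : Set (Matrix n n ℂ)) :=
    Submodule.closed_of_finiteDimensional A.toSubalgebra.toSubmodule
  -- The indicator of `{t}` is continuous on the finite spectrum, so the functional calculus applies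
  -- to it; for `t` outside the spectrum the projection is `0`.
  let f (t : ℝ) : ℝ → ℝ := fun x => if x = t then 1 else 0
  refine ⟨hfin.toFinset, fun t => cfc (f t) y, fun t => ?_, fun t => ?_, fun t => ?_, fun t => ?_,
    ?_, fun t e he => he.cfc_real _⟩
  · have := hclosed
    exact cfc_mem (𝕜' := ℂ) (s := A) (f t) hyA
  · exact (cfc_predicate (f t) y : IsSelfAdjoint _)
  · rw [← cfc_mul _ _ y (hcont _) (hcont _)]
    congr 1
    ext x
    simp [f]
  · have : (t : ℂ) • cfc (f t) y = t • cfc (f t) y := by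
      ext i j; simp
    rw [this, ← cfc_smul t (f t) y (hcont _)]
    have hmul : y * cfc (f t) y = cfc (fun x => x * f t x) y := by
      rw [cfc_mul (fun x => x) (f t) y (hcont _) (hcont _), cfc_id' ℝ y]
    rw [hmul]
    congr 1
    ext x
    by_cases h : x = t <;> simp [f, h]
  · rw [← cfc_sum _ y _ (fun i _ => hcont _), ← cfc_one ℝ y]
    refine cfc_congr fun x hx => ?_
    simp [f, Finset.sum_apply, hfin.mem_toFinset.2 hx]

/-- A nonzero projection that is not minimal splits. -/
theorem exists_subprojection {A : StarSubalgebra ℂ (Matrix n n ℂ)} {e : Matrix n n ℂ}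
    (heA : e ∈ A) (hes : eᴴ = e) (hee : e * e = e) (he0 : e ≠ 0) (hmin : ¬ IsMinProj A e) :
    ∃ q ∈ A, qᴴ = q ∧ q * q = q ∧ q * e = q ∧ e * q = q ∧ q ≠ 0 ∧ q ≠ e := by
  by_contra! hcon
  -- The spectral projections of `e * x * e` commute with `e`, so cutting them by `e` gives
  -- subprojections, each `0` or `e` by `hcon`. They sum to `e ≠ 0`, so one of them is `e`, and `e *
  -- x * e` acts there as its eigenvalue.
  have key : ∀ x ∈ A, xᴴ = x → ∃ c : ℂ, e * x * e = c • e := by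
    intro x hx hxs
    obtain ⟨S, s, hsA, hss, hsi, hsy, hsum, hcomm⟩ := exists_spectral_projections A
      (y := e * x * e) (A.mul_mem (A.mul_mem heA hx) heA)
      (by simp [hes, hxs, Matrix.mul_assoc])
    have hye : e * x * e * e = e * x * e := by rw [Matrix.mul_assoc _ e, hee]
    have hey : e * (e * x * e) = e * x * e := by
      rw [← Matrix.mul_assoc, ← Matrix.mul_assoc, hee]
    have hc (t : ℝ) : s t * e = e * s t := hcomm t e (hye.trans hey.symm)
    have hall (t : ℝ) : s t * e = 0 ∨ s t * e = e := by
      by_contra! h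
      refine h.2 (hcon (s t * e) (A.mul_mem (hsA t) heA) ?_ ?_ ?_ ?_ h.1)
      · rw [Matrix.conjTranspose_mul, hss, hes, hc]
      · calc s t * e * (s t * e) = s t * (e * s t) * e := by simp only [Matrix.mul_assoc]
          _ = s t * s t * (e * e) := by rw [← hc]; simp only [Matrix.mul_assoc]
          _ = s t * e := by rw [hsi, hee]
      · rw [Matrix.mul_assoc, hee]
      · rw [hc, ← Matrix.mul_assoc, hee]
    obtain ⟨t, ht⟩ : ∃ t, s t * e = e := by
      by_contra! h
      apply he0
      rw [← Matrix.one_mul e, ← hsum, Finset.sum_mul]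
      exact Finset.sum_eq_zero fun t _ => (hall t).resolve_right (h t)
    refine ⟨t, ?_⟩
    calc e * x * e = e * x * e * (s t * e) := by rw [ht, hye]
      _ = (t : ℂ) • e := by rw [← Matrix.mul_assoc, hsy, Matrix.smul_mul, ht]
  -- A general `x` is a combination of the Hermitian elements `x + xᴴ` and `I • (x - xᴴ)`.
  refine hmin ⟨heA, hes, hee, he0, fun x hx => ?_⟩
  have hxs := conjTranspose_mem hx
  obtain ⟨c, hc⟩ := key (x + xᴴ) (A.add_mem hx hxs) (by simp [add_comm])
  obtain ⟨c', hc'⟩ := key (Complex.I • (x - xᴴ)) (A.smul_mem (sub_mem hx hxs) _) (by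
    rw [Matrix.conjTranspose_smul, Matrix.conjTranspose_sub, Matrix.conjTranspose_conjTranspose,
      Complex.star_def, Complex.conj_I, neg_smul, ← smul_neg, neg_sub])
  refine ⟨(1 / 2 : ℂ) * (c - Complex.I * c'), ?_⟩
  have hx2 : x = (1 / 2 : ℂ) • ((x + xᴴ) - Complex.I • (Complex.I • (x - xᴴ))) := by
    rw [smul_smul, Complex.I_mul_I, neg_smul, one_smul, sub_neg_eq_add]
    ext i j
    simp only [Matrix.smul_apply, Matrix.add_apply, Matrix.sub_apply, smul_eq_mul]
    ring
  conv_lhs => rw [hx2]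
  rw [Matrix.mul_smul, Matrix.smul_mul, Matrix.mul_sub, Matrix.sub_mul, hc, Matrix.mul_smul,
    Matrix.smul_mul, hc', smul_smul, ← sub_smul, smul_smul]

/-- The range of `q` lies in that of `e`; if they were equal, `q` would fix the range of `e` and so
`q = q * e = e`. This is the descent for splitting a projection. -/
theorem rank_lt_of_subprojection {q e : Matrix n n ℂ} (hqe : q * e = q) (heq : e * q = q)
    (hq : q * q = q) (hne : q ≠ e) : q.rank < e.rank := by
  have hle : LinearMap.range q.mulVecLin ≤ LinearMap.range e.mulVecLin := by
    rw [← heq, Matrix.mulVecLin_mul]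
    exact LinearMap.range_comp_le_range _ _
  refine Submodule.finrank_lt_finrank_of_lt (lt_of_le_of_ne hle fun h => hne ?_)
  have : q * e = e := by
    refine Matrix.ext_of_mulVec_single fun i => ?_
    obtain ⟨w, hw⟩ : e.mulVec (Pi.single i 1) ∈ LinearMap.range q.mulVecLin := h ▸ ⟨_, rfl⟩
    rw [Matrix.mulVecLin_apply] at hw
    rw [← Matrix.mulVec_mulVec, ← hw, Matrix.mulVec_mulVec, hq]
  rw [← hqe, this]

/-- Every projection of `A` is a sum of mutually orthogonal minimal projections. -/
theorem exists_sum_minProj (A : StarSubalgebra ℂ (Matrix n n ℂ)) {e : Matrix n n ℂ}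
    (heA : e ∈ A) (hes : eᴴ = e) (hee : e * e = e) :
    ∃ (ι : Type) (_ : Fintype ι) (p : ι → Matrix n n ℂ), (∀ i, IsMinProj A (p i)) ∧
      (∀ i j, i ≠ j → p i * p j = 0) ∧ (∀ i, p i * e = p i) ∧ (∀ i, e * p i = p i) ∧
      ∑ i, p i = e := by
  induction hr : e.rank using Nat.strong_induction_on generalizing e with
  | _ r ih =>
    by_cases h0 : e = 0
    · exact ⟨Empty, inferInstance, fun i => i.elim, by simp, by simp, by simp, by simp, by simp [h0]⟩
    by_cases hm : IsMinProj A e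
    · exact ⟨Unit, inferInstance, fun _ => e, fun _ => hm, fun i j h => (h rfl).elim, fun _ => hee,
        fun _ => hee, by simp⟩
    obtain ⟨q, hqA, hqs, hqq, hqe, heq, hq0, hqne⟩ := exists_subprojection heA hes hee h0 hm
    have hr1 : (e - q) * e = e - q := by rw [Matrix.sub_mul, hee, hqe]
    have hr2 : e * (e - q) = e - q := by rw [Matrix.mul_sub, hee, heq]
    have hr3 : (e - q) * (e - q) = e - q := by
      rw [Matrix.sub_mul, hr2, Matrix.mul_sub, hqe, hqq, sub_self, sub_zero]
    have hrs : (e - q)ᴴ = e - q := by rw [Matrix.conjTranspose_sub, hes, hqs]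
    obtain ⟨ι, _, p, hp, hpo, hpr, hpl, hpsum⟩ := ih q.rank
      (hr ▸ rank_lt_of_subprojection hqe heq hqq hqne) hqA hqs hqq rfl
    obtain ⟨κ, _, p', hp', hpo', hpr', hpl', hpsum'⟩ := ih (e - q).rank
      (hr ▸ rank_lt_of_subprojection hr1 hr2 hr3 (by simpa using hq0)) (sub_mem heA hqA) hrs hr3 rfl
    have hz : q * (e - q) = 0 := by rw [Matrix.mul_sub, hqe, hqq, sub_self]
    have hz' : (e - q) * q = 0 := by rw [Matrix.sub_mul, heq, hqq, sub_self]
    refine ⟨ι ⊕ κ, inferInstance, Sum.elim p p', ?_, ?_, ?_, ?_, ?_⟩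
    · rintro (i | i)
      exacts [hp i, hp' i]
    · rintro (i | i) (j | j) hij <;> simp only [Sum.elim_inl, Sum.elim_inr]
      · exact hpo i j fun h => hij (h ▸ rfl)
      · rw [← hpr i, ← hpl' j, Matrix.mul_assoc, ← Matrix.mul_assoc q, hz, Matrix.zero_mul,
          Matrix.mul_zero]
      · rw [← hpr' i, ← hpl j, Matrix.mul_assoc, ← Matrix.mul_assoc (e - q), hz', Matrix.zero_mul,
          Matrix.mul_zero]
      · exact hpo' i j fun h => hij (h ▸ rfl)
    · rintro (i | i) <;> simp only [Sum.elim_inl, Sum.elim_inr]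
      · rw [← hpr i, Matrix.mul_assoc, hqe]
      · rw [← hpr' i, Matrix.mul_assoc, hr1]
    · rintro (i | i) <;> simp only [Sum.elim_inl, Sum.elim_inr]
      · rw [← hpl i, ← Matrix.mul_assoc, heq]
      · rw [← hpl' i, ← Matrix.mul_assoc, hr2]
    · simp [hpsum, hpsum']

/-! ### Construction of a block decomposition. -/

/-- A projection matrix is `g gᴴ` for an isometry `g`. -/
theorem exists_isometry_of_projection {p : Matrix n n ℂ} (hps : pᴴ = p) (hpp : p * p = p) :
    ∃ (e : ℕ) (g : Matrix n (Fin e) ℂ), gᴴ * g = 1 ∧ g * gᴴ = p := by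
  classical
  have hH : p.IsHermitian := hps
  set U : Matrix n n ℂ := hH.eigenvectorUnitary.1 with hU
  have hU1 : Uᴴ * U = 1 := Unitary.coe_star_mul_self hH.eigenvectorUnitary
  set D : Matrix n n ℂ := Matrix.diagonal (RCLike.ofReal ∘ hH.eigenvalues) with hD
  have hspec : p = U * D * Uᴴ := by
    conv_lhs => rw [hH.spectral_theorem]
    rw [Unitary.conjStarAlgAut_apply]
    rfl
  have hDp : D = Uᴴ * p * U := by
    rw [hspec]
    calc D = (Uᴴ * U) * D * (Uᴴ * U) := by rw [hU1, Matrix.one_mul, Matrix.mul_one]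
      _ = _ := by simp only [Matrix.mul_assoc]
  have hU2 : U * Uᴴ = 1 := Unitary.coe_mul_star_self hH.eigenvectorUnitary
  have hDD : D * D = D := by
    conv_rhs => rw [hDp, ← hpp]
    rw [hDp]
    calc _ = Uᴴ * p * (U * Uᴴ) * p * U := by simp only [Matrix.mul_assoc]
      _ = _ := by rw [hU2, Matrix.mul_one, Matrix.mul_assoc Uᴴ]
  have hev (i : n) : D i i = 0 ∨ D i i = 1 := by
    have h := congrFun (congrFun hDD i) i
    rw [hD, Matrix.diagonal_mul_diagonal, Matrix.diagonal_apply_eq, Matrix.diagonal_apply_eq] at h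
    rw [hD, Matrix.diagonal_apply_eq]
    exact IsIdempotentElem.iff_eq_zero_or_one.1 h
  -- The columns of `g` are the eigenvectors of `p` with eigenvalue `1`.
  let τ := {i : n // D i i = 1}
  let ε : Fin (Fintype.card τ) ≃ τ := (Fintype.equivFin τ).symm
  have hinj : Function.Injective fun b => (ε b : n) := Subtype.val_injective.comp ε.injective
  refine ⟨Fintype.card τ, U.submatrix id (fun b => (ε b : n)), ?_, ?_⟩
  · ext a b
    have h := congrFun (congrFun hU1 (ε a)) (ε b)
    rw [Matrix.one_apply] at h ⊢
    simp only [hinj.eq_iff] at h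
    rw [← h]
    simp [Matrix.mul_apply]
  · rw [hspec]
    ext k l
    have h1 : (U * D * Uᴴ) k l = ∑ i, if D i i = 1 then U k i * star (U l i) else 0 := by
      rw [Matrix.mul_apply]
      refine Finset.sum_congr rfl fun i _ => ?_
      have : (U * D) k i = U k i * D i i := by simp [hD, Matrix.mul_diagonal]
      rw [this, Matrix.conjTranspose_apply]
      rcases hev i with h | h <;> simp [h]
    rw [h1, ← Finset.sum_filter, Finset.sum_subtype (p := fun i => D i i = 1) _ (by simp),
      Matrix.mul_apply, ← ε.sum_comp]
    rfl

section Assembly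

variable {k : ℕ} {d e : Fin k → ℕ} (w : ∀ c, Fin (d c) → Matrix n n ℂ)
  (g : ∀ c, Matrix n (Fin (e c)) ℂ)

/-- The matrix whose adjoint maps `|a⟩ ⊗ |b⟩` in block `c` to the `b`-th column of `w c a * g c`. -/
def blockFrame : Matrix (Σ c, Fin (d c) × Fin (e c)) n ℂ :=
  Matrix.of fun x m => star ((w x.1 x.2.1 * g x.1) m x.2.2)

-- The entries are the inner products of the columns of the matrices `w c a * g c`, so the
-- hypotheses amount to orthonormality within one label `(c, a)` and orthogonality between different
-- labels.
omit [DecidableEq n] in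
theorem blockFrame_mul_conjTranspose
    (hsame : ∀ c a, (g c)ᴴ * ((w c a)ᴴ * w c a) * g c = 1)
    (hne : ∀ x y : (Σ c, Fin (d c)), x ≠ y → (w x.1 x.2)ᴴ * w y.1 y.2 = 0) :
    blockFrame w g * (blockFrame w g)ᴴ = 1 := by
  ext ⟨c, a, b⟩ ⟨c', a', b'⟩
  have h : (blockFrame w g * (blockFrame w g)ᴴ) ⟨c, a, b⟩ ⟨c', a', b'⟩ =
      ((g c)ᴴ * ((w c a)ᴴ * w c' a') * g c') b b' := by
    have : (g c)ᴴ * ((w c a)ᴴ * w c' a') * g c' = (w c a * g c)ᴴ * (w c' a' * g c') := by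
      simp only [Matrix.conjTranspose_mul, Matrix.mul_assoc]
    rw [this, Matrix.mul_apply, Matrix.mul_apply]
    refine Finset.sum_congr rfl fun m _ => ?_
    simp [blockFrame, Matrix.conjTranspose_apply]
  rw [h]
  by_cases hx : (⟨c, a⟩ : Σ c, Fin (d c)) = ⟨c', a'⟩
  · obtain ⟨rfl, hx⟩ := Sigma.mk.inj_iff.1 hx
    obtain rfl := eq_of_heq hx
    rw [hsame]
    by_cases hb : b = b' <;> simp [Matrix.one_apply, hb]
  · rw [hne _ _ hx, Matrix.mul_zero, Matrix.zero_mul, Matrix.zero_apply, Matrix.one_apply_ne]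
    intro hh
    apply hx
    exact congrArg (fun z : (Σ c, Fin (d c) × Fin (e c)) => (⟨z.1, z.2.1⟩ : Σ c, Fin (d c))) hh

-- Summing over the degeneracy index `b` turns the columns of `g c` into `g c * (g c)ᴴ`. Once this
-- is the initial projection of every `w c a`, the terms on the right are combinations of the matrix
-- units `w c a * (w c a')ᴴ`.
omit [DecidableEq n] in
theorem blockFrame_conj (T : ∀ c, Matrix (Fin (d c)) (Fin (d c)) ℂ) :
    (blockFrame w g)ᴴ *
        Matrix.blockDiagonal' (fun c => T c ⊗ₖ (1 : Matrix (Fin (e c)) (Fin (e c)) ℂ)) *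
        blockFrame w g =
      ∑ c, ∑ a, ∑ a', T c a a' • (w c a * (g c * (g c)ᴴ) * (w c a')ᴴ) := by
  have h1 (c : Fin k) (a : Fin (d c)) (b : Fin (e c)) (l : n) :
      (Matrix.blockDiagonal' (fun c => T c ⊗ₖ (1 : Matrix (Fin (e c)) (Fin (e c)) ℂ)) *
        blockFrame w g) ⟨c, a, b⟩ l = ∑ a', T c a a' * star ((w c a' * g c) l b) := by
    rw [Matrix.mul_apply, Fintype.sum_sigma, Finset.sum_eq_single c, Fintype.sum_prod_type]
    · refine Finset.sum_congr rfl fun a' _ => ?_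
      rw [Finset.sum_eq_single b]
      · simp [Matrix.blockDiagonal'_apply_eq, blockFrame]
      · intro b' _ hb
        simp [Matrix.blockDiagonal'_apply_eq, Matrix.one_apply_ne hb.symm]
      · simp
    · intro c' _ hc
      refine Finset.sum_eq_zero fun y _ => ?_
      rw [Matrix.blockDiagonal'_apply_ne _ _ _ hc.symm, zero_mul]
    · simp
  ext m l
  rw [Matrix.mul_assoc, Matrix.mul_apply, Fintype.sum_sigma]
  simp only [Matrix.sum_apply]
  refine Finset.sum_congr rfl fun c _ => ?_
  rw [Fintype.sum_prod_type]
  refine Finset.sum_congr rfl fun a _ => ?_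
  simp only [h1, Finset.mul_sum]
  rw [Finset.sum_comm]
  refine Finset.sum_congr rfl fun a' _ => ?_
  have h2 : w c a * (g c * (g c)ᴴ) * (w c a')ᴴ = (w c a * g c) * (w c a' * g c)ᴴ := by
    simp only [Matrix.conjTranspose_mul, Matrix.mul_assoc]
  rw [h2, Matrix.smul_apply, Matrix.mul_apply, Finset.smul_sum]
  refine Finset.sum_congr rfl fun b _ => ?_
  simp only [blockFrame, Matrix.conjTranspose_apply, Matrix.of_apply, star_star, smul_eq_mul]
  ring

end Assembly

/-- A complete family of orthogonal minimal projections, sorted into equivalence classes. -/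
theorem exists_sorted_minProj (A : StarSubalgebra ℂ (Matrix n n ℂ)) :
    ∃ (k : ℕ) (d : Fin k → ℕ) (p : (Σ c, Fin (d c)) → Matrix n n ℂ), (∀ c, 0 < d c) ∧
      (∀ x, IsMinProj A (p x)) ∧ (∀ x y, x ≠ y → p x * p y = 0) ∧ ∑ x, p x = 1 ∧
      (∀ x y, x.1 = y.1 ↔ ∃ a ∈ A, p x * a * p y ≠ 0) := by
  classical
  obtain ⟨ι, _, p, hp, hpo, -, -, hsum⟩ := exists_sum_minProj A (e := 1) A.one_mem (by simp)
    (by simp)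
  let s : Setoid ι :=
    { r := fun i j => ∃ a ∈ A, p i * a * p j ≠ 0
      iseqv :=
        { refl := fun i => ⟨1, A.one_mem, by
            rw [Matrix.mul_one, (hp i).mul_self]; exact (hp i).ne_zero⟩
          symm := by
            rintro i j ⟨a, ha, h⟩
            refine ⟨aᴴ, conjTranspose_mem ha, fun h0 => h ?_⟩
            have := congrArg Matrix.conjTranspose h0
            simpa [(hp i).star_eq, (hp j).star_eq, Matrix.mul_assoc] using this
          -- The product of `a` and `b` may vanish in the corner, so `a` is replaced by a partial
          -- isometry `u`, which `uᴴ` undoes.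
          trans := by
            rintro i j l ⟨a, ha, h⟩ ⟨b, hb, h'⟩
            obtain ⟨u, hu, hu1, hu2⟩ := (hp i).exists_partialIsometry (hp j) ha h
            refine ⟨u * p j * b, A.mul_mem (A.mul_mem hu (hp j).mem) hb, fun h0 => h' ?_⟩
            have h1 : uᴴ * (p i * (u * p j * b) * p l) = p j * b * p l := by
              calc _ = uᴴ * (u * uᴴ) * u * p j * b * p l := by
                    rw [hu1]; simp only [Matrix.mul_assoc]
                _ = (uᴴ * u) * (uᴴ * u) * p j * b * p l := by simp only [Matrix.mul_assoc]
                _ = _ := by rw [hu2, (hp j).mul_self, (hp j).mul_self]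
            rw [← h1, h0, Matrix.mul_zero] } }
  let ε : Quotient s ≃ Fin (Fintype.card (Quotient s)) := Fintype.equivFin _
  let cls (i : ι) : Fin (Fintype.card (Quotient s)) := ε (Quotient.mk s i)
  let φ : (Σ c, Fin (Fintype.card {i // cls i = c})) ≃ ι :=
    (Equiv.sigmaCongrRight fun c => (Fintype.equivFin {i // cls i = c}).symm).trans
      (Equiv.sigmaFiberEquiv cls)
  have hφ (x) : cls (φ x) = x.1 := ((Fintype.equivFin {i // cls i = x.1}).symm x.2).2
  refine ⟨_, fun c => Fintype.card {i // cls i = c}, fun x => p (φ x), fun c => ?_, fun x => hp _,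
    fun x y h => hpo _ _ fun h' => h (φ.injective h'), ?_, fun x y => ?_⟩
  · rw [Fintype.card_pos_iff]
    obtain ⟨i, hi⟩ := Quotient.exists_rep (ε.symm c)
    exact ⟨i, by simp [cls, hi]⟩
  · rw [φ.sum_comp p, hsum]
  · rw [← hφ x, ← hφ y]
    exact ε.injective.eq_iff.trans Quotient.eq

-- In each class the first projection `q c` serves as base point. Partial isometries `w c a ∈ A`
-- carry it to the other projections of the class, and an orthonormal basis `g c` of its range spans
-- the degeneracy space.
open scoped ComplexOrder in
theorem exists_blockDecomposition (A : StarSubalgebra ℂ (Matrix n n ℂ)) :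
    Nonempty (BlockDecomposition A) := by
  obtain ⟨k, d, p, hd, hp, hpo, hsum, hrel⟩ := exists_sorted_minProj A
  let q (c : Fin k) : Matrix n n ℂ := p ⟨c, ⟨0, hd c⟩⟩
  have hw (c : Fin k) (a : Fin (d c)) :
      ∃ u ∈ A, u * uᴴ = p ⟨c, a⟩ ∧ uᴴ * u = q c := by
    obtain ⟨x, hx, hne⟩ := (hrel ⟨c, a⟩ ⟨c, ⟨0, hd c⟩⟩).1 rfl
    exact (hp _).exists_partialIsometry (hp _) hx hne
  choose w hwA hw1 hw2 using hw
  have hg (c : Fin k) := exists_isometry_of_projection (hp ⟨c, ⟨0, hd c⟩⟩).star_eq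
    (hp ⟨c, ⟨0, hd c⟩⟩).mul_self
  choose e g hg1 hg2 using hg
  have hq (c : Fin k) : IsMinProj A (q c) := hp _
  have hwq (c a) : w c a * q c = w c a := by
    have h : (w c a * q c - w c a)ᴴ * (w c a * q c - w c a) = 0 := by
      rw [Matrix.conjTranspose_sub, Matrix.conjTranspose_mul, (hq c).star_eq]
      calc _ = q c * ((w c a)ᴴ * w c a) * q c - q c * ((w c a)ᴴ * w c a)
            - ((w c a)ᴴ * w c a) * q c + (w c a)ᴴ * w c a := by
            simp only [Matrix.mul_assoc, Matrix.sub_mul, Matrix.mul_sub]; abel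
        _ = 0 := by rw [hw2, (hq c).mul_self, (hq c).mul_self]; abel
    exact sub_eq_zero.1 (Matrix.conjTranspose_mul_self_eq_zero.1 h)
  have hpw (c a) : p ⟨c, a⟩ * w c a = w c a := by
    rw [← hw1, Matrix.mul_assoc, hw2, hwq]
  have hwp (c a) : (w c a)ᴴ * p ⟨c, a⟩ = (w c a)ᴴ := by
    have := congrArg Matrix.conjTranspose (hpw c a)
    rwa [Matrix.conjTranspose_mul, (hp _).star_eq] at this
  have hconj (T : ∀ c, Matrix (Fin (d c)) (Fin (d c)) ℂ) :
      (blockFrame w g)ᴴ *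
        Matrix.blockDiagonal' (fun c => T c ⊗ₖ (1 : Matrix (Fin (e c)) (Fin (e c)) ℂ)) *
        blockFrame w g = ∑ c, ∑ a, ∑ a', T c a a' • (w c a * (w c a')ᴴ) := by
    rw [blockFrame_conj]
    refine Finset.sum_congr rfl fun c _ => Finset.sum_congr rfl fun a _ =>
      Finset.sum_congr rfl fun a' _ => ?_
    rw [hg2]
    exact congrArg (fun z => T c a a' • (z * (w c a')ᴴ)) (hwq c a)
  refine ⟨{ numBlocks := k, d := d, e := e, d_pos := hd, e_pos := fun c => ?_,
            V := blockFrame w g, conjTranspose_mul_self := ?_, mul_conjTranspose_self := ?_,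
            mem_iff := fun x => ⟨fun hx => ?_, ?_⟩ }⟩
  · refine Nat.pos_of_ne_zero fun h0 => (hq c).ne_zero ?_
    change p _ = 0
    rw [← hg2 c]
    have : IsEmpty (Fin (e c)) := h0 ▸ Fin.isEmpty'
    ext i j
    simp [Matrix.mul_apply]
  -- Taking `T = 1` leaves the sum of all `w c a * (w c a)ᴴ`, that is, of all the minimal
  -- projections.
  · have h := hconj fun _ => 1
    have h1 : (Matrix.blockDiagonal' fun c => (1 : Matrix (Fin (d c)) (Fin (d c)) ℂ) ⊗ₖ
        (1 : Matrix (Fin (e c)) (Fin (e c)) ℂ)) = 1 := by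
      simp only [Matrix.one_kronecker_one]
      exact Matrix.blockDiagonal'_one
    rw [h1, Matrix.mul_one] at h
    rw [h, ← hsum, Fintype.sum_sigma]
    refine Finset.sum_congr rfl fun c _ => Finset.sum_congr rfl fun a _ => ?_
    rw [Finset.sum_eq_single a]
    · simp [hw1]
    · intro b _ hb
      simp [Matrix.one_apply_ne hb.symm]
    · simp
  · refine blockFrame_mul_conjTranspose w g (fun c a => ?_) fun x y hxy => ?_
    · rw [hw2, ← hg1 c]
      change (g c)ᴴ * p _ * g c = _
      rw [← hg2 c]
      calc _ = ((g c)ᴴ * g c) * ((g c)ᴴ * g c) := by simp only [Matrix.mul_assoc]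
        _ = _ := by rw [hg1, Matrix.one_mul]
    · rw [← hpw y.1 y.2, ← hwp x.1 x.2, Matrix.mul_assoc, ← Matrix.mul_assoc (p _) (p _),
        hpo _ _ hxy, Matrix.zero_mul, Matrix.mul_zero]
  -- Multiplying by `w c a' * (w c a)ᴴ` moves this corner of `x` into `p A p` with `p = p ⟨c, a⟩`,
  -- which consists of scalars; these scalars are the entries of `T`.
  · have hent (c : Fin k) (a a' : Fin (d c)) :
        ∃ t : ℂ, p ⟨c, a⟩ * x * p ⟨c, a'⟩ = t • (w c a * (w c a')ᴴ) := by
      obtain ⟨t, ht⟩ := (hp ⟨c, a⟩).corner (x * w c a' * (w c a)ᴴ)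
        (A.mul_mem (A.mul_mem hx (hwA _ _)) (conjTranspose_mem (hwA _ _)))
      refine ⟨t, ?_⟩
      calc p ⟨c, a⟩ * x * p ⟨c, a'⟩ = p ⟨c, a⟩ * x * (w c a' * q c * (w c a')ᴴ) := by
            rw [hwq, hw1]
        _ = p ⟨c, a⟩ * x * (w c a' * ((w c a)ᴴ * w c a) * (w c a')ᴴ) := by rw [hw2]
        _ = p ⟨c, a⟩ * (x * w c a' * (w c a)ᴴ) * (p ⟨c, a⟩ * w c a) * (w c a')ᴴ := by
            rw [hpw]; simp only [Matrix.mul_assoc]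
        _ = (p ⟨c, a⟩ * (x * w c a' * (w c a)ᴴ) * p ⟨c, a⟩) * w c a * (w c a')ᴴ := by
            simp only [Matrix.mul_assoc]
        _ = _ := by rw [ht, Matrix.smul_mul, hpw, Matrix.smul_mul]
    choose T hT using hent
    refine ⟨fun c => Matrix.of (T c), ?_⟩
    rw [hconj]
    have hx1 : x = (∑ y, p y) * x * ∑ y, p y := by rw [hsum, Matrix.one_mul, Matrix.mul_one]
    rw [hx1, Finset.sum_mul, Finset.sum_mul, Fintype.sum_sigma]
    refine Finset.sum_congr rfl fun c _ => Finset.sum_congr rfl fun a _ => ?_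
    rw [Finset.mul_sum, Fintype.sum_sigma, Finset.sum_eq_single c]
    · exact Finset.sum_congr rfl fun a' _ => hT c a a'
    -- Corners between different classes vanish by the definition of the classes.
    · intro c' _ hc
      refine Finset.sum_eq_zero fun a' _ => ?_
      by_contra h
      exact hc ((hrel ⟨c, a⟩ ⟨c', a'⟩).2 ⟨x, hx, h⟩).symm
    · simp
  · rintro ⟨T, rfl⟩
    rw [hconj]
    exact sum_mem fun c _ => sum_mem fun a _ => sum_mem fun a' _ =>
      A.smul_mem (A.mul_mem (hwA _ _) (conjTranspose_mem (hwA _ _))) _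

/-! ### Algebraic properties of the adjoint action. -/

omit [DecidableEq n] in
theorem conjTranspose_mul_mul_conj {m : Type*} [Fintype m] [DecidableEq m] {V : Matrix m n ℂ}
    (hV : V * Vᴴ = 1) (M N : Matrix m m ℂ) :
    Vᴴ * M * V * (Vᴴ * N * V) = Vᴴ * (M * N) * V := by
  calc _ = Vᴴ * M * (V * Vᴴ) * N * V := by simp only [Matrix.mul_assoc]
    _ = _ := by rw [hV, Matrix.mul_one]; simp only [Matrix.mul_assoc]

theorem conjTranspose_mul_coe (U : Matrix.unitaryGroup n ℂ) :
    (U : Matrix n n ℂ)ᴴ * (U : Matrix n n ℂ) = 1 := Unitary.coe_star_mul_self U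

theorem coe_mul_conjTranspose (U : Matrix.unitaryGroup n ℂ) :
    (U : Matrix n n ℂ) * (U : Matrix n n ℂ)ᴴ = 1 := Unitary.coe_mul_star_self U

theorem Ad_mul_apply (U : Matrix.unitaryGroup n ℂ) (a b : Matrix n n ℂ) :
    Ad U (a * b) = Ad U a * Ad U b := by
  have h := conjTranspose_mul_mul_conj (V := (U : Matrix n n ℂ)ᴴ)
    (by simpa using conjTranspose_mul_coe U) a b
  rw [Matrix.conjTranspose_conjTranspose] at h
  exact h.symm

theorem Ad_conjTranspose (U : Matrix.unitaryGroup n ℂ) (a : Matrix n n ℂ) :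
    (Ad U a)ᴴ = Ad U aᴴ := by
  simp [Ad, Matrix.mul_assoc]

theorem Ad_apply_one (U : Matrix.unitaryGroup n ℂ) : Ad U 1 = 1 := by
  rw [Ad, Matrix.mul_one, coe_mul_conjTranspose]

theorem Ad_smul (U : Matrix.unitaryGroup n ℂ) (c : ℂ) (a : Matrix n n ℂ) :
    Ad U (c • a) = c • Ad U a := by simp [Ad]

theorem Ad_zero (U : Matrix.unitaryGroup n ℂ) : Ad U 0 = 0 := by simp [Ad]

theorem Ad_sum {ι : Type*} (U : Matrix.unitaryGroup n ℂ) (s : Finset ι) (f : ι → Matrix n n ℂ) :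
    Ad U (∑ i ∈ s, f i) = ∑ i ∈ s, Ad U (f i) := by
  simp [Ad, Finset.mul_sum, Finset.sum_mul]

theorem trace_Ad (U : Matrix.unitaryGroup n ℂ) (a : Matrix n n ℂ) :
    (Ad U a).trace = a.trace := by
  rw [Ad, Matrix.trace_mul_comm, ← Matrix.mul_assoc, conjTranspose_mul_coe, Matrix.one_mul]

theorem Ad_injective (U : Matrix.unitaryGroup n ℂ) : Function.Injective (Ad U) := fun a b h => by
  rw [← Ad_inv_Ad U a, h, Ad_inv_Ad]

/-- The corner condition ranges over all of `A`, so it transports because `Ad U` maps `A` onto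
itself. -/
theorem IsMinProj.map_Ad {A : StarSubalgebra ℂ (Matrix n n ℂ)} {U : Matrix.unitaryGroup n ℂ}
    (hU : U ∈ normaliser A) {p : Matrix n n ℂ} (hp : IsMinProj A p) : IsMinProj A (Ad U p) where
  mem := hU p hp.mem
  star_eq := by rw [Ad_conjTranspose, hp.star_eq]
  mul_self := by rw [← Ad_mul_apply, hp.mul_self]
  ne_zero h := hp.ne_zero (Ad_injective U (h.trans (Ad_zero U).symm))
  corner x hx := by
    obtain ⟨y, hy, rfl⟩ := exists_Ad_eq A U hU x hx
    obtain ⟨c, hc⟩ := hp.corner y hy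
    exact ⟨c, by rw [← Ad_mul_apply, ← Ad_mul_apply, hc, Ad_smul]⟩

/-! ### Matrix units and central projections of a block decomposition. -/

namespace BlockDecomposition

variable {A : StarSubalgebra ℂ (Matrix n n ℂ)} (D : BlockDecomposition A)

/-- The element `V† (⨁ i, T i ⊗ 1) V` of `A`. -/
def blockElem (T : ∀ i, Matrix (Fin (D.d i)) (Fin (D.d i)) ℂ) : Matrix n n ℂ :=
  D.Vᴴ * Matrix.blockDiagonal' (fun i => T i ⊗ₖ (1 : Matrix (Fin (D.e i)) (Fin (D.e i)) ℂ)) * D.V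

theorem blockElem_mem (T : ∀ i, Matrix (Fin (D.d i)) (Fin (D.d i)) ℂ) : D.blockElem T ∈ A :=
  (D.mem_iff _).2 ⟨T, rfl⟩

theorem blockElem_mul (T S : ∀ i, Matrix (Fin (D.d i)) (Fin (D.d i)) ℂ) :
    D.blockElem T * D.blockElem S = D.blockElem (T * S) := by
  rw [blockElem, blockElem, conjTranspose_mul_mul_conj D.mul_conjTranspose_self, blockElem,
    ← Matrix.blockDiagonal'_mul]
  simp only [← Matrix.mul_kronecker_mul, Matrix.mul_one, Pi.mul_apply]

theorem blockElem_conjTranspose (T : ∀ i, Matrix (Fin (D.d i)) (Fin (D.d i)) ℂ) :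
    (D.blockElem T)ᴴ = D.blockElem fun i => (T i)ᴴ := by
  simp only [blockElem, Matrix.conjTranspose_mul, Matrix.conjTranspose_conjTranspose,
    Matrix.blockDiagonal'_conjTranspose, Matrix.conjTranspose_kronecker, Matrix.conjTranspose_one,
    Matrix.mul_assoc]

theorem blockElem_one : D.blockElem 1 = 1 := by
  have h : (Matrix.blockDiagonal' fun i => (1 : Matrix (Fin (D.d i)) (Fin (D.d i)) ℂ) ⊗ₖ
      (1 : Matrix (Fin (D.e i)) (Fin (D.e i)) ℂ)) = 1 := by
    simp only [Matrix.one_kronecker_one]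
    exact Matrix.blockDiagonal'_one
  simp only [blockElem, Pi.one_apply]
  rw [h, Matrix.mul_one, D.conjTranspose_mul_self]

theorem blockElem_add (T S : ∀ i, Matrix (Fin (D.d i)) (Fin (D.d i)) ℂ) :
    D.blockElem (T + S) = D.blockElem T + D.blockElem S := by
  simp only [blockElem, Pi.add_apply, Matrix.add_kronecker]
  rw [← Matrix.add_mul, ← Matrix.mul_add, ← Matrix.blockDiagonal'_add]
  rfl

theorem blockElem_smul (c : ℂ) (T : ∀ i, Matrix (Fin (D.d i)) (Fin (D.d i)) ℂ) :
    D.blockElem (c • T) = c • D.blockElem T := by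
  simp only [blockElem, Pi.smul_apply, Matrix.smul_kronecker]
  rw [← Matrix.smul_mul, ← Matrix.mul_smul, ← Matrix.blockDiagonal'_smul]
  rfl

theorem trace_blockElem (T : ∀ i, Matrix (Fin (D.d i)) (Fin (D.d i)) ℂ) :
    (D.blockElem T).trace = ∑ i, (T i).trace * D.e i := by
  rw [blockElem, Matrix.trace_mul_comm, ← Matrix.mul_assoc, D.mul_conjTranspose_self,
    Matrix.one_mul, Matrix.trace_blockDiagonal']
  simp [Matrix.trace_kronecker]

/-- `T ↦ V† (⨁ i, T i ⊗ 1) V` as a linear map. -/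
def blockElemLinear : (∀ i, Matrix (Fin (D.d i)) (Fin (D.d i)) ℂ) →ₗ[ℂ] Matrix n n ℂ where
  toFun := D.blockElem
  map_add' := D.blockElem_add
  map_smul' := D.blockElem_smul

/-- The matrix units of `A`. -/
def matUnit (i : Fin D.numBlocks) (a b : Fin (D.d i)) : Matrix n n ℂ :=
  D.blockElem (Pi.single i (Matrix.single a b 1))

theorem matUnit_mem (i : Fin D.numBlocks) (a b : Fin (D.d i)) : D.matUnit i a b ∈ A :=
  D.blockElem_mem _

theorem blockElem_eq_sum (T : ∀ i, Matrix (Fin (D.d i)) (Fin (D.d i)) ℂ) :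
    D.blockElem T = ∑ i, ∑ a, ∑ b, T i a b • D.matUnit i a b := by
  have h : T = ∑ i, ∑ a, ∑ b, T i a b • Pi.single i (Matrix.single a b (1 : ℂ)) := by
    conv_lhs => rw [← Finset.univ_sum_single T]
    refine Finset.sum_congr rfl fun i _ => ?_
    conv_lhs => rw [Matrix.matrix_eq_sum_single (T i)]
    simp only [← Pi.single_smul, Matrix.smul_single, smul_eq_mul, mul_one]
    rw [← LinearMap.single_apply ℂ, map_sum]
    refine Finset.sum_congr rfl fun a _ => ?_
    rw [map_sum]
    rfl
  conv_lhs => rw [h]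
  change D.blockElemLinear _ = _
  simp only [map_sum, map_smul]
  rfl

theorem matUnit_mul_matUnit (i : Fin D.numBlocks) (a b c : Fin (D.d i)) :
    D.matUnit i a b * D.matUnit i b c = D.matUnit i a c := by
  rw [matUnit, matUnit, blockElem_mul, ← Pi.single_mul, Matrix.single_mul_single_same, mul_one,
    matUnit]

theorem matUnit_mul_of_ne (i : Fin D.numBlocks) {b c : Fin (D.d i)} (h : b ≠ c)
    (a a' : Fin (D.d i)) : D.matUnit i a b * D.matUnit i c a' = 0 := by
  rw [matUnit, matUnit, blockElem_mul, ← Pi.single_mul, Matrix.single_mul_single_of_ne _ _ _ _ h,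
    Pi.single_zero]
  exact map_zero D.blockElemLinear

theorem matUnit_mul_mem_mul_of_ne {i j : Fin D.numBlocks} (h : i ≠ j) (a b : Fin (D.d i))
    (c c' : Fin (D.d j)) {x : Matrix n n ℂ} (hx : x ∈ A) :
    D.matUnit i a b * x * D.matUnit j c c' = 0 := by
  obtain ⟨T, rfl⟩ := (D.mem_iff x).1 hx
  change _ * D.blockElem T * _ = 0
  have h0 : (Pi.single i (Matrix.single a b 1) * T * Pi.single j (Matrix.single c c' 1) :
      ∀ i, Matrix (Fin (D.d i)) (Fin (D.d i)) ℂ) = 0 := by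
    ext l : 1
    by_cases hl : l = i
    · subst hl
      simp [Pi.single_eq_of_ne h]
    · simp [Pi.single_eq_of_ne hl]
  rw [matUnit, matUnit, blockElem_mul, blockElem_mul, h0]
  exact map_zero D.blockElemLinear

theorem matUnit_mul_of_block_ne {i j : Fin D.numBlocks} (h : i ≠ j) (a b : Fin (D.d i))
    (c c' : Fin (D.d j)) : D.matUnit i a b * D.matUnit j c c' = 0 := by
  simpa using D.matUnit_mul_mem_mul_of_ne h a b c c' A.one_mem

theorem matUnit_conjTranspose (i : Fin D.numBlocks) (a b : Fin (D.d i)) :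
    (D.matUnit i a b)ᴴ = D.matUnit i b a := by
  rw [matUnit, blockElem_conjTranspose, matUnit]
  congr 1
  ext l : 1
  by_cases hl : l = i
  · subst hl
    simp [Matrix.conjTranspose_single]
  · simp [Pi.single_eq_of_ne hl]

theorem sum_matUnit : ∑ i, ∑ a, D.matUnit i a a = 1 := by
  rw [← D.blockElem_one, D.blockElem_eq_sum]
  refine Finset.sum_congr rfl fun i _ => Finset.sum_congr rfl fun a _ => ?_
  rw [Finset.sum_eq_single a]
  · simp
  · intro b _ hb
    simp [Matrix.one_apply_ne hb.symm]
  · simp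

/-- As `Ad` preserves traces, this and `trace_centralProj` make `e i` and `d i` recoverable after
applying a normalising unitary. -/
theorem trace_matUnit (i : Fin D.numBlocks) (a : Fin (D.d i)) :
    (D.matUnit i a a).trace = D.e i := by
  rw [matUnit, trace_blockElem, Finset.sum_eq_single i]
  · simp
  · intro j _ hj
    simp [Pi.single_eq_of_ne hj]
  · simp

theorem matUnit_ne_zero (i : Fin D.numBlocks) (a : Fin (D.d i)) : D.matUnit i a a ≠ 0 := by
  intro h
  have := D.trace_matUnit i a
  rw [h, Matrix.trace_zero] at this
  exact (D.e_pos i).ne (by exact_mod_cast this)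

theorem isMinProj_matUnit (i : Fin D.numBlocks) (a : Fin (D.d i)) :
    IsMinProj A (D.matUnit i a a) where
  mem := D.matUnit_mem i a a
  star_eq := D.matUnit_conjTranspose i a a
  mul_self := D.matUnit_mul_matUnit i a a a
  ne_zero := D.matUnit_ne_zero i a
  corner x hx := by
    obtain ⟨T, rfl⟩ := (D.mem_iff x).1 hx
    refine ⟨T i a a, ?_⟩
    change _ * D.blockElem T * _ = _
    rw [matUnit, blockElem_mul, blockElem_mul, ← blockElem_smul]
    congr 1
    ext l : 1
    by_cases hl : l = i
    · subst hl
      simp [Matrix.single_mul_mul_single, Matrix.smul_single]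
    · simp [Pi.single_eq_of_ne hl]

/-- The minimal central projections of `A`. -/
def centralProj (i : Fin D.numBlocks) : Matrix n n ℂ := ∑ a, D.matUnit i a a

theorem centralProj_eq (i : Fin D.numBlocks) : D.centralProj i = D.blockElem (Pi.single i 1) := by
  rw [blockElem_eq_sum, Finset.sum_eq_single i, centralProj]
  · refine Finset.sum_congr rfl fun a _ => ?_
    rw [Finset.sum_eq_single a]
    · simp
    · intro b _ hb
      simp [Matrix.one_apply_ne hb.symm]
    · simp
  · intro j _ hj
    simp [Pi.single_eq_of_ne hj]
  · simp

theorem centralProj_comm (i : Fin D.numBlocks) {x : Matrix n n ℂ} (hx : x ∈ A) :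
    D.centralProj i * x = x * D.centralProj i := by
  obtain ⟨T, rfl⟩ := (D.mem_iff x).1 hx
  change _ * D.blockElem T = D.blockElem T * _
  rw [centralProj_eq, blockElem_mul, blockElem_mul]
  congr 1
  ext l : 1
  by_cases hl : l = i
  · subst hl
    simp
  · simp [Pi.single_eq_of_ne hl]

theorem centralProj_mul_matUnit (i : Fin D.numBlocks) (a b : Fin (D.d i)) :
    D.centralProj i * D.matUnit i a b = D.matUnit i a b := by
  rw [centralProj, Finset.sum_mul, Finset.sum_eq_single a]
  · exact D.matUnit_mul_matUnit i a a b
  · exact fun c _ hc => D.matUnit_mul_of_ne i hc _ _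
  · simp

theorem trace_centralProj (i : Fin D.numBlocks) :
    (D.centralProj i).trace = D.d i * D.e i := by
  simp [centralProj, Matrix.trace_sum, trace_matUnit]

/-! ### Block permutations acting on the matrix units. -/

/-- The label of a basis vector of the irreducible space after a permutation of the blocks. -/
abbrev castLabel (ρ : D.labelPerms) (i : Fin D.numBlocks) (a : Fin (D.d i)) :
    Fin (D.d (ρ.1 i)) := Fin.cast (ρ.2 i).1.symm a

/-- Comparing labels as natural numbers makes the formula insensitive to the casts that `indexMap`
introduces between blocks of equal dimensions. -/
theorem blockDiagonal'_single_apply (i : Fin D.numBlocks) (a b : Fin (D.d i)) (x y : D.Index) :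
    Matrix.blockDiagonal' (fun j =>
        (Pi.single i (Matrix.single a b 1) : ∀ j, Matrix (Fin (D.d j)) (Fin (D.d j)) ℂ) j ⊗ₖ
          (1 : Matrix (Fin (D.e j)) (Fin (D.e j)) ℂ)) x y =
      if x.1 = i ∧ y.1 = i ∧ (x.2.1 : ℕ) = a ∧ (y.2.1 : ℕ) = b ∧ (x.2.2 : ℕ) = y.2.2
        then 1 else 0 := by
  obtain ⟨j, a₁, b₁⟩ := x
  obtain ⟨l, a₂, b₂⟩ := y
  by_cases hjl : j = l
  · subst hjl
    rw [Matrix.blockDiagonal'_apply_eq]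
    by_cases hj : j = i
    · subst hj
      simp only [Pi.single_eq_same, Matrix.kroneckerMap_apply, Matrix.single_apply,
        Matrix.one_apply, Fin.ext_iff, true_and]
      by_cases h1 : (a₁ : ℕ) = a <;> by_cases h2 : (a₂ : ℕ) = b <;>
        by_cases h3 : (b₁ : ℕ) = b₂ <;> simp [h1, h2, h3, eq_comm]
    · simp [hj]
  · rw [Matrix.blockDiagonal'_apply_ne _ _ _ hjl, if_neg]
    rintro ⟨h1, h2, -⟩
    exact hjl (h1.trans h2.symm)

theorem permMatrix_mul_eq (ρ : D.labelPerms) {M N : Matrix D.Index D.Index ℂ}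
    (h : ∀ x y, N (D.indexMap ρ x) (D.indexMap ρ y) = M x y) :
    D.permMatrix ρ * M = N * D.permMatrix ρ := by
  ext x y
  obtain ⟨x, rfl⟩ := (Finite.injective_iff_surjective.1 (D.indexMap_injective ρ)) x
  simp [permMatrix, Matrix.mul_apply, h, (D.indexMap_injective ρ).eq_iff]

theorem permUnitary_mul_matUnit (ρ : D.labelPerms) (i : Fin D.numBlocks) (a b : Fin (D.d i)) :
    (D.permUnitary ρ : Matrix n n ℂ) * D.matUnit i a b =
      D.matUnit (ρ.1 i) (D.castLabel ρ i a) (D.castLabel ρ i b) *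
        (D.permUnitary ρ : Matrix n n ℂ) := by
  change (D.Vᴴ * D.permMatrix ρ * D.V) * _ = _ * (D.Vᴴ * D.permMatrix ρ * D.V)
  rw [matUnit, matUnit, blockElem, blockElem, conjTranspose_mul_mul_conj D.mul_conjTranspose_self,
    conjTranspose_mul_mul_conj D.mul_conjTranspose_self]
  congr 2
  refine D.permMatrix_mul_eq ρ fun x y => ?_
  rw [blockDiagonal'_single_apply, blockDiagonal'_single_apply]
  simp [indexMap]

theorem Ad_permUnitary_matUnit (ρ : D.labelPerms) (i : Fin D.numBlocks) (a b : Fin (D.d i)) :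
    Ad (D.permUnitary ρ) (D.matUnit i a b) =
      D.matUnit (ρ.1 i) (D.castLabel ρ i a) (D.castLabel ρ i b) := by
  rw [Ad, permUnitary_mul_matUnit, Matrix.mul_assoc, coe_mul_conjTranspose, Matrix.mul_one]

theorem blockPermGroup_le_normaliser : D.blockPermGroup ≤ normaliser A := by
  rintro _ ⟨ρ, rfl⟩ x hx
  obtain ⟨T, rfl⟩ := (D.mem_iff x).1 hx
  change Ad _ (D.blockElem T) ∈ A
  rw [blockElem_eq_sum]
  simp only [Ad_sum, Ad_smul, Ad_permUnitary_matUnit]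
  exact sum_mem fun i _ => sum_mem fun a _ => sum_mem fun b _ => A.smul_mem (D.matUnit_mem _ _ _) _

/-- Unitaries with the same adjoint action on the matrix units differ by an element of the
commutant. -/
theorem inv_mul_mem_elementwiseGroup {U W : Matrix.unitaryGroup n ℂ}
    (h : ∀ i a b, Ad W (D.matUnit i a b) = Ad U (D.matUnit i a b)) :
    W⁻¹ * U ∈ elementwiseGroup A := by
  intro x hx
  obtain ⟨T, rfl⟩ := (D.mem_iff x).1 hx
  change Ad _ (D.blockElem T) = D.blockElem T
  rw [Ad_mul]
  conv_rhs => rw [← Ad_inv_Ad W (D.blockElem T)]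
  congr 1
  rw [blockElem_eq_sum]
  simp only [Ad_sum, Ad_smul, h]

/-- The label of the first basis vector of the irreducible space of a block. -/
abbrev firstLabel (i : Fin D.numBlocks) : Fin (D.d i) := ⟨0, D.d_pos i⟩

/-! ### Action of a normalising unitary on the blocks. -/

variable {U : Matrix.unitaryGroup n ℂ}

/-- The diagonal matrix units sum to `1` and each factors through the first one of its block, so if
all these corners vanished, the image projection would be zero. -/
theorem exists_mul_mul_matUnit_ne_zero (hU : U ∈ normaliser A) (i : Fin D.numBlocks) :
    ∃ j, ∃ x ∈ A, Ad U (D.matUnit i (D.firstLabel i) (D.firstLabel i)) * x *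
      D.matUnit j (D.firstLabel j) (D.firstLabel j) ≠ 0 := by
  by_contra! h
  refine ((D.isMinProj_matUnit i (D.firstLabel i)).map_Ad hU).ne_zero ?_
  rw [← Matrix.mul_one (Ad U _), ← D.sum_matUnit, Finset.mul_sum]
  refine Finset.sum_eq_zero fun j _ => ?_
  rw [Finset.mul_sum]
  refine Finset.sum_eq_zero fun a _ => ?_
  rw [← D.matUnit_mul_matUnit j a (D.firstLabel j) a,
    ← D.matUnit_mul_matUnit j a (D.firstLabel j) (D.firstLabel j), ← Matrix.mul_assoc,
    ← Matrix.mul_assoc, h j _ (D.matUnit_mem j a _), Matrix.zero_mul]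

/-- If the adjoint action of `U` maps a matrix unit of block `i` to a projection equivalent to one
of block `j`, then it maps the central projection of block `i` to that of block `j`. -/
theorem Ad_centralProj (hU : U ∈ normaliser A) {i j : Fin D.numBlocks} {x : Matrix n n ℂ}
    (hx : x ∈ A)
    (h1 : x * xᴴ = Ad U (D.matUnit i (D.firstLabel i) (D.firstLabel i)))
    (h2 : xᴴ * x = D.matUnit j (D.firstLabel j) (D.firstLabel j)) :
    Ad U (D.centralProj i) = D.centralProj j := by
  set z := D.centralProj j with hz
  set g := Ad U (D.centralProj i) with hg
  have hgc {y : Matrix n n ℂ} (hy : y ∈ A) : g * y = y * g := by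
    obtain ⟨y, hy', rfl⟩ := exists_Ad_eq A U hU y hy
    rw [hg, ← Ad_mul_apply, D.centralProj_comm i hy', Ad_mul_apply]
  have hzc {y : Matrix n n ℂ} (hy : y ∈ A) : z * y = y * z := D.centralProj_comm j hy
  have hxs := conjTranspose_mem hx
  have hgx : g * (x * xᴴ) = x * xᴴ := by
    rw [h1, hg, ← Ad_mul_apply, centralProj_mul_matUnit]
  have hzx : z * (xᴴ * x) = xᴴ * x := by rw [h2, hz, centralProj_mul_matUnit]
  -- A central projection that dominates one of two equivalent projections dominates the other: it
  -- commutes past the partial isometry. The same argument gives `hzf`.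
  have hge : g * (xᴴ * x) = xᴴ * x := by
    have hp : (xᴴ * x) * (xᴴ * x) = xᴴ * x := by rw [h2, matUnit_mul_matUnit]
    calc g * (xᴴ * x) = g * xᴴ * (x * xᴴ) * x := by
          rw [← hp]
          simp only [Matrix.mul_assoc]
      _ = xᴴ * (g * (x * xᴴ)) * x := by rw [hgc hxs]; simp only [Matrix.mul_assoc]
      _ = (xᴴ * x) * (xᴴ * x) := by rw [hgx]; simp only [Matrix.mul_assoc]
      _ = _ := hp
  have hzf : z * (x * xᴴ) = x * xᴴ := by
    have hp : (x * xᴴ) * (x * xᴴ) = x * xᴴ := by rw [h1, ← Ad_mul_apply, matUnit_mul_matUnit]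
    calc z * (x * xᴴ) = z * x * (xᴴ * x) * xᴴ := by
          rw [← hp]
          simp only [Matrix.mul_assoc]
      _ = x * (z * (xᴴ * x)) * xᴴ := by rw [hzc hx]; simp only [Matrix.mul_assoc]
      _ = (x * xᴴ) * (x * xᴴ) := by rw [hzx]; simp only [Matrix.mul_assoc]
      _ = _ := hp
  -- Every diagonal unit of block `j` factors through the first one, which `g` dominates; `hzg` is
  -- the mirror image. Two commuting projections that absorb each other are equal.
  have hgz : g * z = z := by
    rw [hz, centralProj, Finset.mul_sum]
    refine Finset.sum_congr rfl fun a _ => ?_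
    rw [← D.matUnit_mul_matUnit j a (D.firstLabel j) a,
      ← D.matUnit_mul_matUnit j a (D.firstLabel j) (D.firstLabel j), ← h2, ← Matrix.mul_assoc,
      ← Matrix.mul_assoc, hgc (D.matUnit_mem _ _ _), Matrix.mul_assoc _ g, hge]
  have hzg : z * g = g := by
    rw [hg, centralProj, Ad_sum, Finset.mul_sum]
    refine Finset.sum_congr rfl fun a _ => ?_
    rw [← D.matUnit_mul_matUnit i a (D.firstLabel i) a,
      ← D.matUnit_mul_matUnit i a (D.firstLabel i) (D.firstLabel i), Ad_mul_apply, Ad_mul_apply,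
      ← h1, ← Matrix.mul_assoc, ← Matrix.mul_assoc, hzc (hU _ (D.matUnit_mem _ _ _)),
      Matrix.mul_assoc _ z, hzf]
  rw [← hzg, hzc (hU _ ?_), hgz]
  rw [centralProj]
  exact sum_mem fun a _ => D.matUnit_mem _ _ _

/-- A unitary in the normaliser permutes the blocks, up to equivalence of minimal projections. -/
theorem exists_labelPerm (hU : U ∈ normaliser A) :
    ∃ (ρ : D.labelPerms) (x : Fin D.numBlocks → Matrix n n ℂ), (∀ i, x i ∈ A) ∧
      (∀ i, x i * (x i)ᴴ = Ad U (D.matUnit i (D.firstLabel i) (D.firstLabel i))) ∧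
      ∀ i, (x i)ᴴ * x i = D.matUnit (ρ.1 i) (D.firstLabel _) (D.firstLabel _) := by
  have hex (i : Fin D.numBlocks) : ∃ j, ∃ x ∈ A,
      x * xᴴ = Ad U (D.matUnit i (D.firstLabel i) (D.firstLabel i)) ∧
      xᴴ * x = D.matUnit j (D.firstLabel j) (D.firstLabel j) := by
    obtain ⟨j, y, hy, hne⟩ := D.exists_mul_mul_matUnit_ne_zero hU i
    exact ⟨j, ((D.isMinProj_matUnit i _).map_Ad hU).exists_partialIsometry
      (D.isMinProj_matUnit j _) hy hne⟩
  choose π x hxA hx1 hx2 using hex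
  have hz (i) : Ad U (D.centralProj i) = D.centralProj (π i) :=
    D.Ad_centralProj hU (hxA i) (hx1 i) (hx2 i)
  have he (i) : D.e (π i) = D.e i := by
    have h := congrArg Matrix.trace (hx1 i)
    rw [trace_Ad, Matrix.trace_mul_comm, hx2, trace_matUnit, trace_matUnit] at h
    exact_mod_cast h
  have hd (i) : D.d (π i) = D.d i := by
    have h := congrArg Matrix.trace (hz i)
    rw [trace_Ad, trace_centralProj, trace_centralProj, he] at h
    have h' : D.d i * D.e i = D.d (π i) * D.e i := by exact_mod_cast h
    exact (Nat.eq_of_mul_eq_mul_right (D.e_pos i) h').symm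
  have hinj : Function.Injective π := by
    intro i j hij
    by_contra hne
    have hz' : D.centralProj i = D.centralProj j := by
      apply Ad_injective U
      rw [hz, hz, hij]
    refine D.matUnit_ne_zero i (D.firstLabel i) ?_
    rw [← D.centralProj_mul_matUnit, hz', centralProj, Finset.sum_mul]
    exact Finset.sum_eq_zero fun a _ => D.matUnit_mul_of_block_ne (Ne.symm hne) _ _ _ _
  exact ⟨⟨Equiv.ofBijective π (Finite.injective_iff_bijective.1 hinj), fun i => ⟨hd i, he i⟩⟩,
    x, hxA, hx1, hx2⟩

/-- A unitary in the normaliser acts on `A` as a product of a block permutation and an inner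
automorphism. -/
theorem exists_inner_mul_perm (hU : U ∈ normaliser A) :
    ∃ X ∈ innerGroup A, ∃ ρ : D.labelPerms, ∀ i a b,
      Ad (X * D.permUnitary ρ) (D.matUnit i a b) = Ad U (D.matUnit i a b) := by
  obtain ⟨ρ, x, hxA, hx1, hx2⟩ := D.exists_labelPerm hU
  -- Each `G i a b` goes from label `b` of block `ρ i` to its first label, crosses by `x i` to the
  -- image of the first unit of block `i`, and ends at the image of label `a`. The diagonal sum `X`
  -- therefore intertwines the permuted matrix units with their images under `Ad U`.
  let G (i) (a b : Fin (D.d i)) : Matrix n n ℂ := Ad U (D.matUnit i a (D.firstLabel i)) * x i *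
    D.matUnit (ρ.1 i) (D.firstLabel _) (D.castLabel ρ i b)
  let X : Matrix n n ℂ := ∑ i, ∑ a, G i a a
  have hGA (i a b) : G i a b ∈ A :=
    A.mul_mem (A.mul_mem (hU _ (D.matUnit_mem _ _ _)) (hxA i)) (D.matUnit_mem _ _ _)
  have hXA : X ∈ A := sum_mem fun i _ => sum_mem fun a _ => hGA _ _ _
  have hXE (i a b) : X * D.matUnit (ρ.1 i) (D.castLabel ρ i a) (D.castLabel ρ i b) = G i a b := by
    simp only [X, G, Finset.sum_mul]
    rw [Finset.sum_eq_single i, Finset.sum_eq_single a]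
    · rw [Matrix.mul_assoc, matUnit_mul_matUnit]
    · intro c _ hc
      rw [Matrix.mul_assoc, D.matUnit_mul_of_ne _ (fun h => hc (Fin.cast_injective _ h)),
        Matrix.mul_zero]
    · simp
    · intro j _ hj
      refine Finset.sum_eq_zero fun c _ => ?_
      rw [Matrix.mul_assoc, D.matUnit_mul_of_block_ne (fun h => hj (ρ.1.injective h)),
        Matrix.mul_zero]
    · simp
  have hGs (i a b) : (G i a b)ᴴ = D.matUnit (ρ.1 i) (D.castLabel ρ i b) (D.firstLabel _) *
      ((x i)ᴴ * Ad U (D.matUnit i (D.firstLabel i) a)) := by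
    simp only [G, Matrix.conjTranspose_mul, matUnit_conjTranspose, Ad_conjTranspose]
  have hGX (i a b) : G i a b * Xᴴ = Ad U (D.matUnit i a b) := by
    simp only [X, Matrix.conjTranspose_sum, Finset.mul_sum, hGs]
    simp only [G]
    rw [Finset.sum_eq_single i, Finset.sum_eq_single b]
    · calc _ = Ad U (D.matUnit i a (D.firstLabel i)) * x i *
            (D.matUnit (ρ.1 i) (D.firstLabel _) (D.castLabel ρ i b) *
              D.matUnit (ρ.1 i) (D.castLabel ρ i b) (D.firstLabel _)) *
            (x i)ᴴ * Ad U (D.matUnit i (D.firstLabel i) b) := by simp only [Matrix.mul_assoc]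
        _ = Ad U (D.matUnit i a (D.firstLabel i)) * ((x i * (x i)ᴴ) * (x i * (x i)ᴴ)) *
            Ad U (D.matUnit i (D.firstLabel i) b) := by
          rw [matUnit_mul_matUnit, ← hx2]
          simp only [Matrix.mul_assoc]
        _ = _ := by
          rw [hx1]
          simp only [← Ad_mul_apply, matUnit_mul_matUnit]
    · intro c _ hc
      rw [Matrix.mul_assoc, ← Matrix.mul_assoc (D.matUnit _ _ _),
        D.matUnit_mul_of_ne _ (fun h => hc (Fin.cast_injective _ h).symm), Matrix.zero_mul,
        Matrix.mul_zero]
    · simp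
    · intro j _ hj
      refine Finset.sum_eq_zero fun c _ => ?_
      rw [Matrix.mul_assoc, ← Matrix.mul_assoc (D.matUnit _ _ _),
        D.matUnit_mul_of_block_ne (fun h => hj (ρ.1.injective h).symm), Matrix.zero_mul,
        Matrix.mul_zero]
    · simp
  -- By `hGX` this is the sum of the images under `Ad U` of all diagonal matrix units.
  have hXX : X * Xᴴ = 1 := by
    conv_lhs => simp only [X, Finset.sum_mul]
    change ∑ i, ∑ a, G i a a * Xᴴ = 1
    simp only [hGX, ← Ad_sum]
    rw [D.sum_matUnit, Ad_apply_one]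
  refine ⟨⟨X, Matrix.mem_unitaryGroup_iff.2 hXX⟩, hXA, ρ, fun i a b => ?_⟩
  rw [Ad_mul, Ad_permUnitary_matUnit]
  change X * _ * Xᴴ = _
  rw [hXE, hGX]

end BlockDecomposition

/-! ### The remaining inclusions and the main theorem. -/

theorem innerGroup_le_normaliser (A : StarSubalgebra ℂ (Matrix n n ℂ)) :
    innerGroup A ≤ normaliser A := fun _ hU _ ha =>
  A.mul_mem (A.mul_mem hU ha) (conjTranspose_mem hU)

theorem elementwiseGroup_le_normaliser (A : StarSubalgebra ℂ (Matrix n n ℂ)) :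
    elementwiseGroup A ≤ normaliser A := fun U hU a ha => by
  rw [hU a ha]
  exact ha

end WallAlgebra

theorem mainTheorem9 {n : Type*} [Fintype n] [DecidableEq n]
    (A : StarSubalgebra ℂ (Matrix n n ℂ)) :
    Nonempty (WallAlgebra.BlockDecomposition A) ∧
    ∀ D : WallAlgebra.BlockDecomposition A,
      WallAlgebra.normaliser A =
        Subgroup.closure
          ((WallAlgebra.innerGroup A : Set (Matrix.unitaryGroup n ℂ)) ∪
            (WallAlgebra.elementwiseGroup A : Set (Matrix.unitaryGroup n ℂ)) ∪
            (D.blockPermGroup : Set (Matrix.unitaryGroup n ℂ))) := by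
  refine ⟨WallAlgebra.exists_blockDecomposition A, fun D => le_antisymm (fun U hU => ?_) ?_⟩
  · obtain ⟨X, hX, ρ, h⟩ := D.exists_inner_mul_perm hU
    rw [show U = X * D.permUnitary ρ * ((X * D.permUnitary ρ)⁻¹ * U) by group]
    exact mul_mem (mul_mem (Subgroup.subset_closure (.inl (.inl hX)))
      (Subgroup.subset_closure (.inr ⟨ρ, rfl⟩)))
      (Subgroup.subset_closure (.inl (.inr (D.inv_mul_mem_elementwiseGroup h))))
  · rw [Subgroup.closure_le]
    exact Set.union_subset (Set.union_subset (WallAlgebra.innerGroup_le_normaliser A)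
      (WallAlgebra.elementwiseGroup_le_normaliser A)) D.blockPermGroup_le_normaliser
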